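/- Let $n\ge 0$ be an integer and let $f:\mathbb{R}^n\to[0,\infty)$ be an even convex function with $0<\int_{\mathbb{R}^n}e^{-f(x)}\,dx<\infty$. Let $\mathcal{L}f(x)=\sup_{y\in\mathbb{R}^n}\bigl[\langle x,y\rangle-f(y)\bigr]\in(-\infty,+\infty]$ be its Legendre transform, with the convention $e^{-\infty}=0$. Then $$\int_{\mathbb{R}^n}e^{-f(x)}\,dx\;\int_{\mathbb{R}^n}e^{-\mathcal{L}f(x)}\,dx\;\le\;(2\pi)^n .$$ -/

import Mathlib

open MeasureTheory

/-- The Legendre transform `𝓛 φ (x) = sup_y (⟨x, y⟩ - φ y)` of a real function on a Euclidean space.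
The supremum may be infinite, so it is taken in the extended reals. -/
noncomputable def legendreTransform {n : ℕ} (φ : EuclideanSpace ℝ (Fin n) → ℝ)
    (x : EuclideanSpace ℝ (Fin n)) : EReal :=
  ⨆ y : EuclideanSpace ℝ (Fin n), ((inner ℝ x y - φ y : ℝ) : EReal)

/-! Call `φ`, `ψ` polar with constant `c` if `φ x * ψ y ≤ c * exp (-⟨x, y⟩)`. The bound `c * (2π)^n`
for even lower semicontinuous polar pairs goes by induction on dimension. Split off one coordinate.
`symmFst` averages `φ` geometrically along it, and `symmSnd` averages `ψ` in the remaining ones. The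
pair stays polar (`symmFst_mul_symmSnd_le`), neither integral decreases, by Prékopa–Leindler, and
both functions become even in each block separately. For fixed first coordinates `s`, `t` the slices
are polar with constant `c * exp (-(s * t))`, so induction makes the slice integrals an even polar
pair on the line. There `s = exp x` turns products into sums, and Prékopa–Leindler compares with the
Gaussian. The theorem follows for `exp (-f)` cut off to a ball, then by exhaustion. -/

/-! ### Brunn–Minkowski on the line -/

open Set in
/-- One-dimensional Brunn–Minkowski inequality for compact sets. -/
theorem Real.volume_add_volume_le_of_isCompact {A B C : Set ℝ} (hA : IsCompact A)
    (hB : IsCompact B) (hA' : A.Nonempty) (hB' : B.Nonempty)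
    (h : ∀ a ∈ A, ∀ b ∈ B, a + b ∈ C) : volume A + volume B ≤ volume C := by
  obtain ⟨k, hkA, hk⟩ := hA.exists_isGreatest hA'
  obtain ⟨l, hlB, hl⟩ := hB.exists_isLeast hB'
  -- The translates `A + l` and `B + k` lie in `C` and meet at most in `k + l`.
  have h1 : volume ((fun x => x + (-l)) ⁻¹' A) = volume A := measure_preimage_add_right _ _ _
  have h2 : volume ((fun x => x + (-k)) ⁻¹' B) = volume B := measure_preimage_add_right _ _ _
  have hm : MeasurableSet ((fun x => x + (-k)) ⁻¹' B) :=
    hB.measurableSet.preimage (measurable_add_const _)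
  have h3 := measure_union_add_inter (μ := volume) ((fun x => x + (-l)) ⁻¹' A) hm
  have h4 : volume (((fun x => x + (-l)) ⁻¹' A) ∩ ((fun x => x + (-k)) ⁻¹' B)) = 0 := by
    refine measure_mono_null (t := {k + l}) ?_ (by simp)
    rintro x ⟨hx, hx'⟩
    have := hk hx
    have := hl hx'
    simp only [mem_singleton_iff]
    linarith
  rw [h4, add_zero, h1, h2] at h3
  rw [← h3]
  refine measure_mono ?_
  rintro x (hx | hx)
  · simpa using h _ hx _ hlB
  · simpa using h _ hkA _ hx

/-- One-dimensional Brunn–Minkowski inequality. -/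
theorem Real.volume_add_volume_le {A B C : Set ℝ} (hA : MeasurableSet A) (hB : MeasurableSet B)
    (hA' : A.Nonempty) (hB' : B.Nonempty) (h : ∀ a ∈ A, ∀ b ∈ B, a + b ∈ C) :
    volume A + volume B ≤ volume C := by
  obtain ⟨a₀, ha₀⟩ := hA'
  obtain ⟨b₀, hb₀⟩ := hB'
  rw [hA.measure_eq_iSup_isCompact, hB.measure_eq_iSup_isCompact]
  simp only [iSup_and']
  refine ENNReal.biSup_add_biSup_le' ⟨∅, by simp⟩ ⟨∅, by simp⟩ ?_
  rintro K ⟨hKA, hK⟩ L ⟨hLB, hL⟩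
  refine (add_le_add (measure_mono (Set.subset_insert a₀ K))
    (measure_mono (Set.subset_insert b₀ L))).trans
    (Real.volume_add_volume_le_of_isCompact (hK.insert a₀) (hL.insert b₀)
      (Set.insert_nonempty _ _) (Set.insert_nonempty _ _) fun a ha b hb => ?_)
  exact h a (Set.insert_subset ha₀ hKA ha) b (Set.insert_subset hb₀ hLB hb)

/-- One-dimensional Brunn–Minkowski inequality for midpoints. -/
theorem Real.volume_add_volume_le_two_mul {A B C : Set ℝ} (hA : MeasurableSet A)
    (hB : MeasurableSet B) (hA' : A.Nonempty) (hB' : B.Nonempty)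
    (h : ∀ a ∈ A, ∀ b ∈ B, (a + b) / 2 ∈ C) : volume A + volume B ≤ 2 * volume C := by
  have h1 : volume ((· * (2⁻¹ : ℝ)) ⁻¹' C) = 2 * volume C := by
    rw [Real.volume_preimage_mul_right (by norm_num)]
    simp
  rw [← h1]
  exact Real.volume_add_volume_le hA hB hA' hB' h

/-! ### Prékopa–Leindler on the line -/

open Set in
/-- One-dimensional Prékopa–Leindler inequality in additive form, for functions with essential
range `[0, 1]`. -/
theorem lintegral_add_lintegral_le_of_level_sets {f g h : ℝ → ℝ} (hf : Measurable f)
    (hg : Measurable g) (hh : Measurable h) (hf0 : ∀ x, 0 ≤ f x) (hg0 : ∀ x, 0 ≤ g x)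
    (hh0 : ∀ x, 0 ≤ h x) (hf1 : ∀ x, f x ≤ 1) (hg1 : ∀ x, g x ≤ 1)
    (hf2 : ∀ t < 1, ∃ x, t < f x) (hg2 : ∀ t < 1, ∃ x, t < g x)
    (H : ∀ t > 0, ∀ x y, t < f x → t < g y → t < h ((x + y) / 2)) :
    (∫⁻ x, ENNReal.ofReal (f x)) + ∫⁻ x, ENNReal.ofReal (g x) ≤
      2 * ∫⁻ x, ENNReal.ofReal (h x) := by
  rw [lintegral_eq_lintegral_meas_lt _ (.of_forall hf0) hf.aemeasurable,
    lintegral_eq_lintegral_meas_lt _ (.of_forall hg0) hg.aemeasurable,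
    lintegral_eq_lintegral_meas_lt _ (.of_forall hh0) hh.aemeasurable,
    ← lintegral_const_mul' _ _ (by simp), ← lintegral_add_left]
  · refine setLIntegral_mono' measurableSet_Ioi fun t ht => ?_
    -- Brunn–Minkowski needs both level sets nonempty; with equal suprema they become empty at the
    -- same height.
    rcases lt_or_ge t 1 with h1 | h1
    · exact Real.volume_add_volume_le_two_mul (hf measurableSet_Ioi) (hg measurableSet_Ioi)
        (hf2 t h1) (hg2 t h1) fun a ha b hb => H t ht a b ha hb
    · have e1 : {a | t < f a} = ∅ := by
        ext a; simpa using (hf1 a).trans h1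
      have e2 : {a | t < g a} = ∅ := by
        ext a; simpa using (hg1 a).trans h1
      simp [e1, e2]
  · exact Antitone.measurable fun s t hst => measure_mono fun x hx => lt_of_le_of_lt hst hx

theorem ENNReal.mul_le_sq_of_add_le_two_mul {a b c : ENNReal} (h : a + b ≤ 2 * c) :
    a * b ≤ c ^ 2 := by
  rcases eq_or_ne c ⊤ with rfl | hc
  · simp
  have hab : a + b ≠ ⊤ := ne_top_of_le_ne_top (ENNReal.mul_ne_top (by simp) hc) h
  lift c to NNReal using hc
  lift a to NNReal using fun h => hab (by simp [h])
  lift b to NNReal using fun h => hab (by simp [h])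
  norm_cast at h ⊢
  have h' : (a : ℝ) + b ≤ 2 * c := by exact_mod_cast h
  have : (a : ℝ) * b ≤ c ^ 2 := by
    nlinarith [sq_nonneg ((a : ℝ) - b), a.2, b.2, c.2, mul_self_le_mul_self (by positivity) h']
  exact_mod_cast this

/-- One-dimensional Prékopa–Leindler inequality for bounded functions. -/
theorem prekopa_leindler_real_of_le {f g h : ℝ → ENNReal} (hf : Measurable f)
    (hg : Measurable g) (hh : Measurable h) {N : NNReal} (hfN : ∀ x, f x ≤ N) (hgN : ∀ x, g x ≤ N)
    (H : ∀ x y, f x * g y ≤ h ((x + y) / 2) ^ 2) :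
    (∫⁻ x, f x) * (∫⁻ x, g x) ≤ (∫⁻ x, h x) ^ 2 := by
  have hMf : (⨆ x, f x) ≠ ⊤ := ne_top_of_le_ne_top ENNReal.coe_ne_top (iSup_le hfN)
  have hMg : (⨆ x, g x) ≠ ⊤ := ne_top_of_le_ne_top ENNReal.coe_ne_top (iSup_le hgN)
  have hlf := fun x => le_iSup f x
  have hlg := fun x => le_iSup g x
  have hlf' : ∀ t < ⨆ x, f x, ∃ x, t < f x := fun t ht => lt_iSup_iff.1 ht
  have hlg' : ∀ t < ⨆ x, g x, ∃ x, t < g x := fun t ht => lt_iSup_iff.1 ht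
  generalize (⨆ x, f x) = a at *
  generalize (⨆ x, g x) = b at *
  lift a to NNReal using hMf
  lift b to NNReal using hMg
  rcases eq_or_ne a 0 with rfl | ha
  · have : f = 0 := by ext x; simpa using hlf x
    simp [this]
  rcases eq_or_ne b 0 with rfl | hb
  · have : g = 0 := by ext x; simpa using hlg x
    simp [this]
  -- Dividing by `a` and `b` gives both functions supremum 1; `h` must then be scaled by the
  -- geometric mean. Capping `h` at `c` keeps `toReal` from sending `⊤` to 0.
  set c : NNReal := NNReal.sqrt (a * b) with hc
  have hc2 : c ^ 2 = a * b := by simp [hc]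
  have hc0 : c ≠ 0 := by simp [hc, ha, hb]
  have key : ∀ (u : ℝ → ENNReal) (d : NNReal), d ≠ 0 → (∀ x, u x ≤ d) →
      (∫⁻ x, u x) = d * ∫⁻ x, ENNReal.ofReal ((u x / d).toReal) := by
    intro u d hd hu
    rw [← lintegral_const_mul' _ _ ENNReal.coe_ne_top]
    congr 1 with x
    rw [ENNReal.ofReal_toReal (ENNReal.div_ne_top (ne_top_of_le_ne_top ENNReal.coe_ne_top (hu x))
      (by simpa using hd)), ENNReal.mul_div_cancel (by simpa using hd) ENNReal.coe_ne_top]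
  have hlt : ∀ (u : ENNReal) (d : NNReal), d ≠ 0 → u ≤ d → ∀ t : ℝ, 0 < t →
      (t < (u / d).toReal ↔ ENNReal.ofReal t * d < u) := by
    intro u d hd hu t ht
    rw [← ENNReal.ofReal_lt_iff_lt_toReal ht.le (ENNReal.div_ne_top
      (ne_top_of_le_ne_top ENNReal.coe_ne_top hu) (by simpa using hd)),
      ENNReal.lt_div_iff_mul_lt (by simp [hd]) (by simp)]
  have hle : ∀ (u : ENNReal) (d : NNReal), d ≠ 0 → u ≤ d → (u / d).toReal ≤ 1 := by
    intro u d hd hu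
    refine ENNReal.toReal_le_of_le_ofReal zero_le_one ?_
    simpa using ENNReal.div_le_of_le_mul (by simpa using hu)
  have hmain : (∫⁻ x, ENNReal.ofReal ((f x / a).toReal)) + ∫⁻ x, ENNReal.ofReal ((g x / b).toReal) ≤
      2 * ∫⁻ x, ENNReal.ofReal ((min (h x) c / c).toReal) := by
    apply lintegral_add_lintegral_le_of_level_sets (by fun_prop) (by fun_prop) (by fun_prop)
      (fun _ => ENNReal.toReal_nonneg) (fun _ => ENNReal.toReal_nonneg)
      (fun _ => ENNReal.toReal_nonneg) (fun x => hle _ _ ha (hlf x)) (fun x => hle _ _ hb (hlg x))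
    · intro t ht
      -- `hlt` needs a positive level, so `t` is raised to an arbitrary one in `(0, 1)`.
      obtain ⟨x, hx⟩ := hlf' (ENNReal.ofReal (max t 2⁻¹) * a) (by
        have h1 : ENNReal.ofReal (max t 2⁻¹) < 1 := by
          rw [ENNReal.ofReal_lt_one]; exact max_lt ht (by norm_num)
        simpa using (ENNReal.mul_lt_mul_iff_left (by simpa using ha) ENNReal.coe_ne_top).2 h1)
      exact ⟨x, lt_of_le_of_lt (le_max_left t 2⁻¹)
        ((hlt _ _ ha (hlf x) _ (lt_max_of_lt_right (by norm_num))).2 hx)⟩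
    · intro t ht
      obtain ⟨x, hx⟩ := hlg' (ENNReal.ofReal (max t 2⁻¹) * b) (by
        have h1 : ENNReal.ofReal (max t 2⁻¹) < 1 := by
          rw [ENNReal.ofReal_lt_one]; exact max_lt ht (by norm_num)
        simpa using (ENNReal.mul_lt_mul_iff_left (by simpa using hb) ENNReal.coe_ne_top).2 h1)
      exact ⟨x, lt_of_le_of_lt (le_max_left t 2⁻¹)
        ((hlt _ _ hb (hlg x) _ (lt_max_of_lt_right (by norm_num))).2 hx)⟩
    · intro t ht x y hx hy
      have ht1 : t < 1 := hx.trans_le (hle _ _ ha (hlf x))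
      rw [hlt _ _ ha (hlf x) t ht] at hx
      rw [hlt _ _ hb (hlg y) t ht] at hy
      rw [hlt _ _ hc0 (min_le_right _ _) t ht, lt_min_iff]
      constructor
      · have h1 := (ENNReal.mul_lt_mul hx hy).trans_le (H x y)
        have h2 : ENNReal.ofReal t * a * (ENNReal.ofReal t * b) = (ENNReal.ofReal t * c) ^ 2 := by
          rw [mul_pow, ← ENNReal.coe_pow, hc2]; push_cast; ring
        rw [h2] at h1
        exact lt_of_pow_lt_pow_left' 2 h1
      · have h1 : ENNReal.ofReal t < 1 := by rwa [ENNReal.ofReal_lt_one]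
        simpa using (ENNReal.mul_lt_mul_iff_left (by simpa using hc0) ENNReal.coe_ne_top).2 h1
  calc (∫⁻ x, f x) * (∫⁻ x, g x)
      = (c : ENNReal) ^ 2 * ((∫⁻ x, ENNReal.ofReal ((f x / a).toReal)) *
          ∫⁻ x, ENNReal.ofReal ((g x / b).toReal)) := by
        rw [key f a ha hlf, key g b hb hlg, ← ENNReal.coe_pow, hc2]; push_cast; ring
    _ ≤ (c : ENNReal) ^ 2 * (∫⁻ x, ENNReal.ofReal ((min (h x) c / c).toReal)) ^ 2 := by
        gcongr
        exact ENNReal.mul_le_sq_of_add_le_two_mul hmain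
    _ = (∫⁻ x, min (h x) c) ^ 2 := by
        rw [key (fun x => min (h x) c) c hc0 (fun x => min_le_right _ _), mul_pow]
    _ ≤ (∫⁻ x, h x) ^ 2 := by
        gcongr with x
        exact min_le_left _ _

theorem lintegral_eq_iSup_lintegral_min_natCast {α : Type*} [MeasurableSpace α] (μ : Measure α)
    {f : α → ENNReal} (hf : Measurable f) :
    ∫⁻ x, f x ∂μ = ⨆ N : ℕ, ∫⁻ x, min (f x) N ∂μ := by
  rw [← lintegral_iSup (fun N => hf.min measurable_const)
    (fun i j hij x => min_le_min_left _ (by exact_mod_cast hij))]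
  congr 1 with x
  rw [← inf_iSup_eq, ENNReal.iSup_natCast, inf_top_eq]

/-- One-dimensional Prékopa–Leindler inequality. -/
theorem prekopa_leindler_real {f g h : ℝ → ENNReal} (hf : Measurable f)
    (hg : Measurable g) (hh : Measurable h)
    (H : ∀ x y, f x * g y ≤ h ((x + y) / 2) ^ 2) :
    (∫⁻ x, f x) * (∫⁻ x, g x) ≤ (∫⁻ x, h x) ^ 2 := by
  rw [lintegral_eq_iSup_lintegral_min_natCast _ hf, lintegral_eq_iSup_lintegral_min_natCast _ hg,
    ENNReal.iSup_mul]
  refine iSup_le fun N => ?_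
  rw [ENNReal.mul_iSup]
  refine iSup_le fun M => ?_
  refine prekopa_leindler_real_of_le (N := max N M) (hf.min measurable_const)
    (hg.min measurable_const) hh (fun x => ?_) (fun x => ?_) fun x y => le_trans ?_ (H x y)
  · exact (min_le_right _ _).trans (by exact_mod_cast le_max_left _ _)
  · exact (min_le_right _ _).trans (by exact_mod_cast le_max_right _ _)
  · gcongr <;> exact min_le_left _ _

/-! ### Prékopa–Leindler in dimension `n` -/

theorem lintegral_fin_zero (f : (Fin 0 → ℝ) → ENNReal) : ∫⁻ x, f x = f 0 := by
  have h : (volume : Measure (Fin 0 → ℝ)) = Measure.dirac 0 := Measure.volume_pi_eq_dirac 0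
  rw [h, lintegral_dirac]

theorem lintegral_fin_succ {n : ℕ} {f : (Fin (n + 1) → ℝ) → ENNReal} (hf : Measurable f) :
    ∫⁻ x, f x = ∫⁻ s : ℝ, ∫⁻ x : Fin n → ℝ, f (Fin.cons s x) := by
  have h := (volume_preserving_piFinSuccAbove (fun _ : Fin (n + 1) => ℝ) 0).symm
  rw [← h.lintegral_comp hf, Measure.volume_eq_prod, lintegral_prod]
  · simp [MeasurableEquiv.piFinSuccAbove, Fin.insertNthEquiv]
  · exact (hf.comp h.measurable).aemeasurable

theorem continuous_fin_cons {n : ℕ} :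
    Continuous fun p : ℝ × (Fin n → ℝ) => (Fin.cons p.1 p.2 : Fin (n + 1) → ℝ) := by
  refine continuous_pi fun i => ?_
  refine Fin.cases ?_ (fun j => ?_) i
  · simpa using continuous_fst
  · simpa using! (continuous_apply j).comp continuous_snd

/-- The Prékopa–Leindler inequality, for midpoints. -/
theorem prekopa_leindler {n : ℕ} {f g h : (Fin n → ℝ) → ENNReal} (hf : Measurable f)
    (hg : Measurable g) (hh : Measurable h)
    (H : ∀ x y, f x * g y ≤ h ((2⁻¹ : ℝ) • (x + y)) ^ 2) :
    (∫⁻ x, f x) * (∫⁻ x, g x) ≤ (∫⁻ x, h x) ^ 2 := by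
  induction n with
  | zero =>
    simp only [lintegral_fin_zero]
    convert H 0 0 using 3
  | succ n ih =>
    rw [lintegral_fin_succ hf, lintegral_fin_succ hg, lintegral_fin_succ hh]
    have hm : ∀ {u : (Fin (n + 1) → ℝ) → ENNReal}, Measurable u →
        Measurable fun s : ℝ => ∫⁻ x : Fin n → ℝ, u (Fin.cons s x) := fun hu =>
      Measurable.lintegral_prod_right' (hu.comp continuous_fin_cons.measurable)
    have hs : ∀ {u : (Fin (n + 1) → ℝ) → ENNReal}, Measurable u → ∀ s : ℝ,
        Measurable fun x : Fin n → ℝ => u (Fin.cons s x) := fun hu s =>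
      (hu.comp continuous_fin_cons.measurable).comp measurable_prodMk_left
    refine prekopa_leindler_real (hm hf) (hm hg) (hm hh) fun s t => ?_
    refine ih (hs hf s) (hs hg t) (hs hh _) fun x y => ?_
    convert H (Fin.cons s x) (Fin.cons t y) using 3
    ext i
    refine Fin.cases ?_ (fun j => ?_) i
    · simp; ring
    · simp; ring

/-! ### Lower semicontinuity, which survives arbitrary suprema and so gives measurability -/

theorem LowerSemicontinuous.ennreal_mul {α : Type*} [TopologicalSpace α] {f g : α → ENNReal}
    (hf : LowerSemicontinuous f) (hg : LowerSemicontinuous g) :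
    LowerSemicontinuous fun x => f x * g x := by
  intro x a ha
  obtain ⟨c, hac, hc⟩ := exists_between ha
  have h : ∃ p < f x, ∃ q < g x, c < p * q := by
    by_contra! h
    exact hc.not_ge (ENNReal.mul_le_of_forall_lt h)
  obtain ⟨p, hp, q, hq, hpq⟩ := h
  filter_upwards [hf x p hp, hg x q hq] with y h1 h2
  exact (hac.trans hpq).trans_le (by gcongr)

theorem LowerSemicontinuous.ennreal_rpow {α : Type*} [TopologicalSpace α] {f : α → ENNReal}
    (hf : LowerSemicontinuous f) {p : ℝ} (hp : 0 ≤ p) :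
    LowerSemicontinuous fun x => f x ^ p :=
  ENNReal.continuous_rpow_const.comp_lowerSemicontinuous hf (ENNReal.monotone_rpow_of_nonneg hp)

theorem ENNReal.le_of_sq_le_sq {a b : ENNReal} (h : a ^ 2 ≤ b ^ 2) : a ≤ b :=
  (ENNReal.pow_right_strictMono two_ne_zero).le_iff_le.1 h

theorem ENNReal.rpow_half_sq (a : ENNReal) : (a ^ (2⁻¹ : ℝ)) ^ 2 = a := by
  rw [← ENNReal.rpow_natCast, ← ENNReal.rpow_mul]
  simp

/-! ### Blaschke–Santaló on the line -/

theorem lintegral_Ioi_eq_lintegral_exp (u : ℝ → ENNReal) :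
    ∫⁻ r in Set.Ioi 0, u r = ∫⁻ x, ENNReal.ofReal (Real.exp x) * u (Real.exp x) := by
  have h := lintegral_image_eq_lintegral_abs_deriv_mul (s := Set.univ) MeasurableSet.univ
    (fun x _ => (Real.hasDerivAt_exp x).hasDerivWithinAt) Real.exp_injective.injOn u
  simpa [Set.image_univ, Real.range_exp, abs_of_pos, Real.exp_pos] using h

theorem lintegral_Ioi_gaussian_sq :
    (∫⁻ r in Set.Ioi (0 : ℝ), ENNReal.ofReal (Real.exp (-(1 / 2) * r ^ 2))) ^ 2 =
      ENNReal.ofReal (Real.pi / 2) := by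
  rw [← ofReal_integral_eq_lintegral_ofReal
    (integrable_exp_neg_mul_sq (by norm_num)).integrableOn
    (.of_forall fun _ => (Real.exp_pos _).le), integral_gaussian_Ioi,
    ← ENNReal.ofReal_pow (by positivity), div_pow, Real.sq_sqrt (by positivity)]
  congr 1
  ring

/-- One-dimensional functional Blaschke–Santaló inequality on the half-line. -/
theorem lintegral_Ioi_mul_lintegral_Ioi_le {F G : ℝ → ENNReal} (hF : Measurable F)
    (hG : Measurable G) {C : ENNReal} (hC : C ≠ 0) (hC' : C ≠ ⊤)
    (H : ∀ s > 0, ∀ t > 0, F s * G t ≤ C * ENNReal.ofReal (Real.exp (-(s * t)))) :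
    (∫⁻ s in Set.Ioi 0, F s) * (∫⁻ s in Set.Ioi 0, G s) ≤ C * ENNReal.ofReal (Real.pi / 2) := by
  have key : (∫⁻ s in Set.Ioi 0, C⁻¹ * F s) * (∫⁻ s in Set.Ioi 0, G s) ≤
      ENNReal.ofReal (Real.pi / 2) := by
    rw [← lintegral_Ioi_gaussian_sq]
    simp only [lintegral_Ioi_eq_lintegral_exp]
    -- The midpoint of exponents is the geometric mean `r` of the two points, so `exp (-r ^ 2 / 2)`
    -- squares to the polar bound; the Jacobians match too.
    refine prekopa_leindler_real (by fun_prop) (by fun_prop) (by fun_prop) fun s t => ?_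
    have h := H _ (Real.exp_pos s) _ (Real.exp_pos t)
    calc _ = ENNReal.ofReal (Real.exp s) * ENNReal.ofReal (Real.exp t) *
          (C⁻¹ * (F (Real.exp s) * G (Real.exp t))) := by ring
      _ ≤ ENNReal.ofReal (Real.exp s) * ENNReal.ofReal (Real.exp t) *
          (C⁻¹ * (C * ENNReal.ofReal (Real.exp (-(Real.exp s * Real.exp t))))) := by gcongr
      _ = ENNReal.ofReal (Real.exp s) * ENNReal.ofReal (Real.exp t) *
          ENNReal.ofReal (Real.exp (-(Real.exp s * Real.exp t))) := by
        rw [← mul_assoc C⁻¹, ENNReal.inv_mul_cancel hC hC', one_mul]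
      _ = _ := by
        rw [← ENNReal.ofReal_mul (by positivity), ← ENNReal.ofReal_mul (by positivity),
          ← ENNReal.ofReal_mul (by positivity), ← ENNReal.ofReal_pow (by positivity)]
        congr 1
        simp only [← Real.exp_add, ← Real.exp_nat_mul]
        congr 1
        push_cast
        ring_nf
  rw [lintegral_const_mul' _ _ (ENNReal.inv_ne_top.2 hC), mul_assoc] at key
  calc _ = C * (C⁻¹ * ((∫⁻ s in Set.Ioi 0, F s) * (∫⁻ s in Set.Ioi 0, G s))) := by
        rw [← mul_assoc C, ENNReal.mul_inv_cancel hC hC', one_mul]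
    _ ≤ _ := by gcongr

theorem lintegral_eq_two_mul_lintegral_Ioi {F : ℝ → ENNReal} (hF : Function.Even F) :
    ∫⁻ s, F s = 2 * ∫⁻ s in Set.Ioi 0, F s := by
  have h1 : ∫⁻ s in Set.Iic 0, F s = ∫⁻ s in Set.Ioi 0, F s := by
    have h := (Measure.measurePreserving_neg (volume : Measure ℝ)).setLIntegral_comp_preimage_emb
      (MeasurableEquiv.neg ℝ).measurableEmbedding F (Set.Ici 0)
    simp only [hF _, Set.neg_preimage, Set.neg_Ici, neg_zero] at h
    rw [h, setLIntegral_congr Ioi_ae_eq_Ici]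
  rw [← lintegral_add_compl F (measurableSet_Ioi (a := (0 : ℝ))), Set.compl_Ioi, h1, two_mul]

/-- One-dimensional functional Blaschke–Santaló inequality for even functions. -/
theorem lintegral_mul_lintegral_le_of_even {F G : ℝ → ENNReal} (hF : Measurable F)
    (hG : Measurable G) (hF' : Function.Even F) (hG' : Function.Even G) {C : ENNReal}
    (hC : C ≠ 0) (hC' : C ≠ ⊤)
    (H : ∀ s > 0, ∀ t > 0, F s * G t ≤ C * ENNReal.ofReal (Real.exp (-(s * t)))) :
    (∫⁻ s, F s) * (∫⁻ s, G s) ≤ C * ENNReal.ofReal (2 * Real.pi) := by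
  rw [lintegral_eq_two_mul_lintegral_Ioi hF', lintegral_eq_two_mul_lintegral_Ioi hG']
  calc _ = 4 * ((∫⁻ s in Set.Ioi 0, F s) * (∫⁻ s in Set.Ioi 0, G s)) := by ring
    _ ≤ 4 * (C * ENNReal.ofReal (Real.pi / 2)) :=
      mul_le_mul_right (lintegral_Ioi_mul_lintegral_Ioi_le hF hG hC hC' H) _
    _ = C * (ENNReal.ofReal 4 * ENNReal.ofReal (Real.pi / 2)) := by
      rw [ENNReal.ofReal_ofNat]; ring
    _ = _ := by
      rw [← ENNReal.ofReal_mul (by norm_num)]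
      congr 2
      ring

/-! ### Dual symmetrizations -/

/-- Symmetrization of a function in the first variable, by averaging over reflections along it. -/
noncomputable def symmFst {E : Type*} (φ : ℝ × E → ENNReal) (p : ℝ × E) : ENNReal :=
  ⨆ u : ℝ, (φ (u + p.1, p.2) * φ (u - p.1, p.2)) ^ (2⁻¹ : ℝ)

/-- The symmetrization dual to `symmFst`, by averaging in the second variable. -/
noncomputable def symmSnd {E : Type*} [AddGroup E] (ψ : ℝ × E → ENNReal) (p : ℝ × E) : ENNReal :=
  ⨆ v : E, (ψ (p.1, p.2 + v) * ψ (-p.1, p.2 - v)) ^ (2⁻¹ : ℝ)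

theorem LowerSemicontinuous.symmFst {E : Type*} [TopologicalSpace E] {φ : ℝ × E → ENNReal}
    (hφ : LowerSemicontinuous φ) : LowerSemicontinuous (symmFst φ) :=
  lowerSemicontinuous_iSup fun u =>
    ((hφ.comp (g := fun p : ℝ × E => (u + p.1, p.2)) (by fun_prop)).ennreal_mul
      (hφ.comp (g := fun p : ℝ × E => (u - p.1, p.2)) (by fun_prop))).ennreal_rpow (by norm_num)

theorem LowerSemicontinuous.symmSnd {E : Type*} [TopologicalSpace E] [AddGroup E]
    [IsTopologicalAddGroup E] {ψ : ℝ × E → ENNReal}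
    (hψ : LowerSemicontinuous ψ) : LowerSemicontinuous (symmSnd ψ) :=
  lowerSemicontinuous_iSup fun v =>
    ((hψ.comp (g := fun p : ℝ × E => (p.1, p.2 + v)) (by fun_prop)).ennreal_mul
      (hψ.comp (g := fun p : ℝ × E => (-p.1, p.2 - v)) (by fun_prop))).ennreal_rpow (by norm_num)

theorem symmFst_neg_fst {E : Type*} (φ : ℝ × E → ENNReal) (s : ℝ) (x : E) :
    symmFst φ (-s, x) = symmFst φ (s, x) := by
  simp only [symmFst]
  congr 1 with u
  rw [mul_comm, sub_neg_eq_add, ← sub_eq_add_neg]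

theorem symmFst_neg_snd {E : Type*} [AddGroup E] {φ : ℝ × E → ENNReal}
    (hφ : Function.Even φ) (s : ℝ) (x : E) :
    symmFst φ (s, -x) = symmFst φ (s, x) := by
  simp only [symmFst]
  refine (Equiv.neg ℝ).iSup_congr fun u => ?_
  have h1 := hφ (u + s, -x)
  have h2 := hφ (u - s, -x)
  simp only [Prod.neg_mk, neg_neg, neg_add_rev, neg_sub] at h1 h2
  rw [← h1, ← h2, mul_comm]
  simp only [Equiv.neg_apply]
  congr 4 <;> ring

theorem symmSnd_neg_snd {E : Type*} [AddCommGroup E] {ψ : ℝ × E → ENNReal}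
    (hψ : Function.Even ψ) (s : ℝ) (x : E) :
    symmSnd ψ (s, -x) = symmSnd ψ (s, x) := by
  simp only [symmSnd]
  congr 1 with v
  have h1 := hψ (s, -x + v)
  have h2 := hψ (-s, -x - v)
  simp only [Prod.neg_mk, neg_neg, neg_add_rev, neg_sub] at h1 h2
  rw [← h1, ← h2, mul_comm]
  congr 4 <;> abel

theorem symmSnd_neg_fst {E : Type*} [AddCommGroup E] (ψ : ℝ × E → ENNReal) (s : ℝ) (x : E) :
    symmSnd ψ (-s, x) = symmSnd ψ (s, x) := by
  simp only [symmSnd]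
  refine (Equiv.neg E).iSup_congr fun v => ?_
  rw [mul_comm]
  simp only [Equiv.neg_apply, neg_neg, sub_neg_eq_add, ← sub_eq_add_neg]

/-- Pair `(u + s, x)` with `(t, y + v)` and `(u - s, x)` with `(-t, y - v)`: in the sum of the two
pairings `u` and `v` cancel, leaving twice the pairing of `(s, x)` and `(t, y)`. -/
theorem symmFst_mul_symmSnd_le {n : ℕ} {φ ψ : ℝ × (Fin n → ℝ) → ENNReal} {c : ENNReal}
    (H : ∀ p q, φ p * ψ q ≤ c * ENNReal.ofReal (Real.exp (-(p.1 * q.1 + p.2 ⬝ᵥ q.2))))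
    (p q : ℝ × (Fin n → ℝ)) : symmFst φ p * symmSnd ψ q ≤
      c * ENNReal.ofReal (Real.exp (-(p.1 * q.1 + p.2 ⬝ᵥ q.2))) := by
  obtain ⟨s, x⟩ := p
  obtain ⟨t, y⟩ := q
  simp only [symmFst, symmSnd, ENNReal.iSup_mul, ENNReal.mul_iSup]
  refine iSup_le fun v => iSup_le fun u => ?_
  rw [← ENNReal.mul_rpow_of_nonneg _ _ (by norm_num)]
  apply ENNReal.le_of_sq_le_sq
  rw [ENNReal.rpow_half_sq]
  calc _ = (φ (u + s, x) * ψ (t, y + v)) * (φ (u - s, x) * ψ (-t, y - v)) := by ring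
    _ ≤ _ := mul_le_mul' (H _ _) (H _ _)
    _ = _ := by
      rw [mul_mul_mul_comm, mul_pow, ← pow_two, ← ENNReal.ofReal_mul (by positivity),
        ← ENNReal.ofReal_pow (by positivity), ← Real.exp_add, ← Real.exp_nat_mul]
      congr 3
      simp only [dotProduct_add, dotProduct_sub]
      push_cast
      ring

/-- Prékopa–Leindler for the fibre function and its reflection, which have equal integrals. -/
theorem lintegral_le_lintegral_symmFst {E : Type*} [TopologicalSpace E] [MeasurableSpace E]
    [AddGroup E] [OpensMeasurableSpace (ℝ × E)] {φ : ℝ × E → ENNReal}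
    (hφ : LowerSemicontinuous φ) (x : E) :
    ∫⁻ s, φ (s, x) ≤ ∫⁻ s, symmFst φ (s, x) := by
  have hm : ∀ {u : ℝ × E → ENNReal}, LowerSemicontinuous u → Measurable fun s => u (s, x) :=
    fun hu => hu.measurable.comp measurable_prodMk_right
  apply ENNReal.le_of_sq_le_sq
  have h1 : ∫⁻ s, φ (-s, x) = ∫⁻ s, φ (s, x) := lintegral_neg_eq_self (fun s => φ (s, x))
  calc (∫⁻ s, φ (s, x)) ^ 2 = (∫⁻ s, φ (s, x)) * ∫⁻ s, φ (-s, x) := by rw [h1, pow_two]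
    _ ≤ _ := by
      refine prekopa_leindler_real (hm hφ) ((hm hφ).comp measurable_neg) (hm hφ.symmFst)
        fun s t => ?_
      rw [← ENNReal.rpow_half_sq (φ (s, x) * φ (-t, x))]
      gcongr
      -- At the midpoint `(s + t) / 2` this `u` recovers the points `s` and `-t`.
      refine le_iSup_of_le ((s - t) / 2) (le_of_eq ?_)
      congr 4 <;> ring

/-- Prékopa–Leindler for the slices at `t` and `-t`; joint evenness of `ψ` equates their integrals.
-/
theorem lintegral_le_lintegral_symmSnd {n : ℕ} {ψ : ℝ × (Fin n → ℝ) → ENNReal}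
    (hψ : LowerSemicontinuous ψ) (hψ' : Function.Even ψ) (t : ℝ) :
    ∫⁻ y, ψ (t, y) ≤ ∫⁻ y, symmSnd ψ (t, y) := by
  have hm : ∀ {u : ℝ × (Fin n → ℝ) → ENNReal}, LowerSemicontinuous u → ∀ t,
      Measurable fun y => u (t, y) := fun hu t => hu.measurable.comp measurable_prodMk_left
  apply ENNReal.le_of_sq_le_sq
  have h1 : ∫⁻ y, ψ (-t, y) = ∫⁻ y, ψ (t, y) := by
    rw [← lintegral_neg_eq_self (fun y => ψ (t, y))]
    congr 1 with y
    rw [← hψ' (t, -y)]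
    simp
  calc (∫⁻ y, ψ (t, y)) ^ 2 = (∫⁻ y, ψ (t, y)) * ∫⁻ y, ψ (-t, y) := by rw [h1, pow_two]
    _ ≤ _ := by
      refine prekopa_leindler (hm hψ t) (hm hψ (-t)) (hm hψ.symmSnd t) fun x y => ?_
      rw [← ENNReal.rpow_half_sq (ψ (t, x) * ψ (-t, y))]
      gcongr
      refine le_iSup_of_le ((2⁻¹ : ℝ) • (x - y)) (le_of_eq ?_)
      congr 4 <;> (ext i; simp; ring)

/-! ### Induction on dimension -/

/-- Functional Blaschke–Santaló inequality for even lower semicontinuous functions. -/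
theorem lintegral_mul_lintegral_le_of_mul_le_exp_neg_dotProduct {n : ℕ}
    {φ ψ : (Fin n → ℝ) → ENNReal} (hφ : LowerSemicontinuous φ) (hψ : LowerSemicontinuous ψ)
    (hφ' : Function.Even φ) (hψ' : Function.Even ψ) {c : ENNReal} (hc : c ≠ 0) (hc' : c ≠ ⊤)
    (H : ∀ x y, φ x * ψ y ≤ c * ENNReal.ofReal (Real.exp (-(x ⬝ᵥ y)))) :
    (∫⁻ x, φ x) * (∫⁻ x, ψ x) ≤ c * ENNReal.ofReal (2 * Real.pi) ^ n := by
  -- `c` must vary: the slices absorb the factor `exp (-(s * t))` into it.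
  induction n generalizing c with
  | zero =>
    rw [lintegral_fin_zero, lintegral_fin_zero]
    simpa using H 0 0
  | succ n ih =>
    rw [lintegral_fin_succ hφ.measurable, lintegral_fin_succ hψ.measurable]
    set Φ : ℝ × (Fin n → ℝ) → ENNReal := fun p => φ (Fin.cons p.1 p.2) with hΦ
    set Ψ : ℝ × (Fin n → ℝ) → ENNReal := fun p => ψ (Fin.cons p.1 p.2) with hΨ
    have hΦl : LowerSemicontinuous Φ := hφ.comp continuous_fin_cons
    have hΨl : LowerSemicontinuous Ψ := hψ.comp continuous_fin_cons
    have hneg : ∀ p : ℝ × (Fin n → ℝ), (Fin.cons (-p).1 (-p).2 : Fin (n + 1) → ℝ) =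
        -Fin.cons p.1 p.2 := by
      intro p
      ext i
      refine Fin.cases ?_ (fun j => ?_) i <;> simp
    have hΦe : Function.Even Φ := fun p => by simp only [hΦ, hneg, hφ' _]
    have hΨe : Function.Even Ψ := fun p => by simp only [hΨ, hneg, hψ' _]
    have H' : ∀ p q, Φ p * Ψ q ≤
        c * ENNReal.ofReal (Real.exp (-(p.1 * q.1 + p.2 ⬝ᵥ q.2))) := by
      intro p q
      convert H (Fin.cons p.1 p.2) (Fin.cons q.1 q.2) using 5
      simp [dotProduct, Fin.sum_univ_succ]
    have hm : ∀ {u : ℝ × (Fin n → ℝ) → ENNReal}, LowerSemicontinuous u →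
        Measurable fun s : ℝ => ∫⁻ x : Fin n → ℝ, u (s, x) := fun hu =>
      Measurable.lintegral_prod_right' hu.measurable
    have h1 : ∫⁻ s, ∫⁻ x, Φ (s, x) ≤ ∫⁻ s, ∫⁻ x, symmFst Φ (s, x) := by
      rw [lintegral_lintegral_swap (f := fun s x => Φ (s, x)) hΦl.measurable.aemeasurable,
        lintegral_lintegral_swap (f := fun s x => symmFst Φ (s, x))
          hΦl.symmFst.measurable.aemeasurable]
      exact lintegral_mono fun x => lintegral_le_lintegral_symmFst hΦl x
    have h2 : ∫⁻ s, ∫⁻ x, Ψ (s, x) ≤ ∫⁻ s, ∫⁻ x, symmSnd Ψ (s, x) :=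
      lintegral_mono fun t => lintegral_le_lintegral_symmSnd hΨl hΨe t
    refine (mul_le_mul' h1 h2).trans ?_
    rw [pow_succ, ← mul_assoc]
    refine lintegral_mul_lintegral_le_of_even (hm hΦl.symmFst) (hm hΨl.symmSnd)
      (fun s => by simp only [symmFst_neg_fst]) (fun s => by simp only [symmSnd_neg_fst])
      (mul_ne_zero hc (pow_ne_zero _ (by simp [Real.pi_pos])))
      (ENNReal.mul_ne_top hc' (ENNReal.pow_ne_top ENNReal.ofReal_ne_top)) fun s _ t _ => ?_
    rw [mul_right_comm]
    refine ih (hΦl.symmFst.comp (by fun_prop)) (hΨl.symmSnd.comp (by fun_prop))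
      (fun x => symmFst_neg_snd hΦe s x) (fun x => symmSnd_neg_snd hΨe t x)
      (mul_ne_zero hc (by simp [Real.exp_pos]))
      (ENNReal.mul_ne_top hc' ENNReal.ofReal_ne_top) fun x y => ?_
    convert symmFst_mul_symmSnd_le H' (s, x) (t, y) using 1
    · rfl
    · rw [mul_assoc, ← ENNReal.ofReal_mul (by positivity), ← Real.exp_add]
      congr 3
      ring

/-- Functional Blaschke–Santaló inequality for even lower semicontinuous functions on Euclidean
space. -/
theorem lintegral_mul_lintegral_le_of_mul_le_exp_neg_inner {n : ℕ}
    {φ ψ : EuclideanSpace ℝ (Fin n) → ENNReal} (hφ : LowerSemicontinuous φ)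
    (hψ : LowerSemicontinuous ψ) (hφ' : Function.Even φ) (hψ' : Function.Even ψ)
    (H : ∀ x y, φ x * ψ y ≤ ENNReal.ofReal (Real.exp (-(inner ℝ x y)))) :
    (∫⁻ x, φ x) * (∫⁻ x, ψ x) ≤ ENNReal.ofReal (2 * Real.pi) ^ n := by
  have hl := PiLp.continuous_toLp 2 (fun _ : Fin n => ℝ)
  have hv := PiLp.volume_preserving_toLp (Fin n)
  rw [← hv.lintegral_comp hφ.measurable, ← hv.lintegral_comp hψ.measurable]
  simpa using lintegral_mul_lintegral_le_of_mul_le_exp_neg_dotProduct (c := 1) (hφ.comp hl)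
    (hψ.comp hl) (fun x => by simp [hφ' _]) (fun x => by simp [hψ' _]) one_ne_zero
    ENNReal.one_ne_top fun x y => by
      have h := H (WithLp.toLp 2 x) (WithLp.toLp 2 y)
      rw [EuclideanSpace.inner_toLp_toLp, star_trivial, dotProduct_comm] at h
      simpa using h

/-! ### Truncated Legendre transforms and exhaustion by balls -/

section

variable {E : Type*} [NormedAddCommGroup E] [InnerProductSpace ℝ E]

/-- The Legendre transform of the restriction of a function to a ball around the origin. -/
noncomputable def legendreBall (f : E → ℝ) (R : ℝ) (y : E) : ℝ :=
  ⨆ x : Metric.ball (0 : E) R, (inner ℝ y (x : E) - f x)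

theorem inner_sub_le_legendreBall {f : E → ℝ} (hf : ∀ x, 0 ≤ f x) {R : ℝ} {x : E}
    (hx : x ∈ Metric.ball 0 R) (y : E) : inner ℝ y x - f x ≤ legendreBall f R y := by
  refine le_ciSup (f := fun x : Metric.ball (0 : E) R => inner ℝ y (x : E) - f x)
    ⟨‖y‖ * R, ?_⟩ ⟨x, hx⟩
  rintro _ ⟨⟨z, hz⟩, rfl⟩
  have hz' : ‖z‖ < R := by simpa using hz
  have := real_inner_le_norm y z
  have := hf z
  have := mul_le_mul_of_nonneg_left hz'.le (norm_nonneg y)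
  simp only
  linarith

theorem legendreBall_even {f : E → ℝ} (hf : Function.Even f) (R : ℝ) :
    Function.Even (legendreBall f R) := by
  intro y
  let e : Metric.ball (0 : E) R ≃ Metric.ball (0 : E) R :=
    (Equiv.neg E).subtypeEquiv fun x => by simp
  refine e.iSup_congr fun x => ?_
  simp [e, hf _]

theorem continuous_legendreBall {f : E → ℝ} (hf : ∀ x, 0 ≤ f x) {R : ℝ} (hR : 0 < R) :
    Continuous (legendreBall f R) := by
  have : Nonempty (Metric.ball (0 : E) R) := ⟨⟨0, by simpa using hR⟩⟩
  refine (LipschitzWith.of_le_add_mul ⟨R, hR.le⟩ fun y z => ?_).continuous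
  refine ciSup_le fun ⟨x, hx⟩ => ?_
  have h1 := inner_sub_le_legendreBall hf hx z
  have hx' : ‖x‖ < R := by simpa using hx
  have h2 := real_inner_le_norm (y - z) x
  have h3 := mul_le_mul_of_nonneg_left hx'.le (norm_nonneg (y - z))
  rw [inner_sub_left] at h2
  rw [dist_eq_norm]
  change _ ≤ legendreBall f R z + R * ‖y - z‖
  linarith

end

theorem exp_neg_legendreTransform_le {n : ℕ} {f : EuclideanSpace ℝ (Fin n) → ℝ} {R : ℝ}
    (hR : 0 < R) (y : EuclideanSpace ℝ (Fin n)) :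
    EReal.exp (-legendreTransform f y) ≤ ENNReal.ofReal (Real.exp (-legendreBall f R y)) := by
  have : Nonempty (Metric.ball (0 : EuclideanSpace ℝ (Fin n)) R) := ⟨⟨0, by simpa using hR⟩⟩
  rw [← EReal.exp_coe, EReal.exp_le_exp_iff, EReal.coe_neg, EReal.neg_le_neg_iff]
  -- Testing against real `z` above the transform covers infinite values as well.
  refine EReal.le_of_forall_lt_iff_le.1 fun z hz => ?_
  rw [EReal.coe_le_coe_iff]
  refine ciSup_le fun x => ?_
  exact EReal.coe_le_coe_iff.1 ((le_iSup (fun x => ((inner ℝ y x - f x : ℝ) : EReal))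
    (x : EuclideanSpace ℝ (Fin n))).trans hz.le)

/-- Truncation supplies lower semicontinuity: the ball is open, and the truncated transform is
finite and Lipschitz. Being smaller than the full transform, it only enlarges the second integral.
-/
theorem setLIntegral_ball_exp_neg_mul_le {n : ℕ} {f : EuclideanSpace ℝ (Fin n) → ℝ}
    (hf_nonneg : ∀ x, 0 ≤ f x) (hf_even : Function.Even f) (hf : Continuous f) {R : ℝ}
    (hR : 0 < R) :
    (∫⁻ x in Metric.ball 0 R, ENNReal.ofReal (Real.exp (-f x))) *
      (∫⁻ x, EReal.exp (-legendreTransform f x)) ≤ ENNReal.ofReal (2 * Real.pi) ^ n := by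
  refine (mul_le_mul_right (lintegral_mono fun y => exp_neg_legendreTransform_le hR y) _).trans ?_
  rw [← lintegral_indicator Metric.isOpen_ball.measurableSet]
  have hL := continuous_legendreBall hf_nonneg hR
  refine lintegral_mul_lintegral_le_of_mul_le_exp_neg_inner ?_ ?_ ?_ ?_ fun x y => ?_
  · have h := (ENNReal.continuous_ofReal.comp
      (Real.continuous_exp.comp hf.neg)).lowerSemicontinuous.ennreal_mul
      ((Metric.isOpen_ball (x := (0 : EuclideanSpace ℝ (Fin n))) (ε := R)).lowerSemicontinuous_indicator
        (zero_le : (0 : ENNReal) ≤ 1))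
    convert h using 2 with x
    by_cases hx : x ∈ Metric.ball 0 R <;> simp [hx]
  · exact (ENNReal.continuous_ofReal.comp
      (Real.continuous_exp.comp hL.neg)).lowerSemicontinuous
  · intro x
    simp [Set.indicator, hf_even _]
  · intro y
    simp only [legendreBall_even hf_even R _]
  · by_cases hx : x ∈ Metric.ball 0 R
    · rw [Set.indicator_of_mem hx, ← ENNReal.ofReal_mul (Real.exp_pos _).le, ← Real.exp_add]
      refine ENNReal.ofReal_le_ofReal (Real.exp_le_exp.2 ?_)
      have := inner_sub_le_legendreBall hf_nonneg hx y
      rw [real_inner_comm] at this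
      linarith
    · simp [hx]

theorem lintegral_eq_iSup_setLIntegral_ball {E : Type*} [NormedAddCommGroup E]
    [MeasurableSpace E] (μ : Measure E) (u : E → ENNReal) :
    ∫⁻ x, u x ∂μ = ⨆ N : ℕ, ∫⁻ x in Metric.ball 0 (N + 1 : ℝ), u x ∂μ := by
  rw [← setLIntegral_iUnion_of_directed]
  · rw [Set.iUnion_eq_univ_iff.2 fun x => ?_, setLIntegral_univ]
    obtain ⟨N, hN⟩ := exists_nat_gt ‖x‖
    exact ⟨N, by simp; linarith⟩
  · refine Monotone.directed_le fun i j hij => Metric.ball_subset_ball ?_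
    gcongr

theorem theoremc91 (n : ℕ) (f : EuclideanSpace ℝ (Fin n) → ℝ)
    (hf_nonneg : ∀ x, 0 ≤ f x)
    (hf_even : Function.Even f)
    (hf_convex : ConvexOn ℝ Set.univ f)
    (hf_pos : 0 < (∫⁻ x, ENNReal.ofReal (Real.exp (-f x))))
    (hf_fin : (∫⁻ x, ENNReal.ofReal (Real.exp (-f x))) < ⊤) :
    (∫⁻ x, ENNReal.ofReal (Real.exp (-f x))) * (∫⁻ x, EReal.exp (-legendreTransform f x)) ≤
      ENNReal.ofReal ((2 * Real.pi) ^ n) := by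
  -- Convexity enters only through continuity.
  have hf : Continuous f := continuousOn_univ.1 (hf_convex.continuousOn isOpen_univ)
  rw [lintegral_eq_iSup_setLIntegral_ball volume (fun x => ENNReal.ofReal (Real.exp (-f x))),
    ENNReal.iSup_mul, ENNReal.ofReal_pow (by positivity)]
  exact iSup_le fun N => setLIntegral_ball_exp_neg_mul_le hf_nonneg hf_even hf (by positivity)
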